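/- Let $q \in [1,2)$ and let $a, b > -2$ be real numbers with $\frac{2+b}{q} = 1 + a$ and $1 \le a < 2$. Then there is a constant $C > 0$, depending only on $a, b, q$, such that for every $u \in C_c^\infty(\mathbb{R}^2, \mathbb{R}^2)$, $$\left(\int_{\mathbb{R}^2} |x|^{b}\, |u(x)|^q \, dx\right)^{1/q} \le C \int_{\mathbb{R}^2} |x|^a\, |\mathrm{D}_{\mathrm{sym}} u(x)| \, dx,$$ where $\mathrm{D}_{\mathrm{sym}} u = \frac12\left(Du + (Du)^T\right)$ is the symmetrized gradient, $|x|$ and $|u(x)|$ are Euclidean norms, and $|\mathrm{D}_{\mathrm{sym}} u(x)|$ is the Frobenius norm of the matrix. -/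

import Mathlib

open MeasureTheory
open scoped ContDiff
-- `‖M‖` is the Frobenius (Euclidean) norm of a matrix `M`.
open scoped Matrix.Norms.Frobenius

namespace KornHardy

noncomputable section

/-- The plane with its Euclidean norm and Lebesgue measure. -/
abbrev Plane : Type := EuclideanSpace ℝ (Fin 2)

/-- The Jacobian matrix `Du(x)`, with entries `(Du)_{ij} = ∂_j u_i`. -/
def jacobian (u : Plane → Plane) (x : Plane) : Matrix (Fin 2) (Fin 2) ℝ :=
  Matrix.of fun i j => (fderiv ℝ u x (EuclideanSpace.single j 1)) i

/-- The symmetrized gradient `(Du + (Du)ᵀ) / 2`. -/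
def Dsym (u : Plane → Plane) (x : Plane) : Matrix (Fin 2) (Fin 2) ℝ :=
  (1 / 2 : ℝ) • (jacobian u x + (jacobian u x).transpose)

end

end KornHardy


/-!
The derivative of `t ↦ ⟪u (x + t e), e⟫` is `⟪Du e, e⟫ = ⟪(D_sym u) e, e⟫`, since the skew part of
`Du` drops out of the quadratic form. So `|⟪u x, e⟫|` is at most the integral of `|D_sym u|` along
the ray from `x` in direction `e`, and also along the opposite ray; one of the two never gets closer
to the origin than `x`. Averaging over the unit sphere, where `v ↦ ∫ |⟪v, e⟫| de` is a norm, gives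
`|u x| ≤ C ∫_{|y| ≥ |x|} |x - y| ^ (1 - n) |D_sym u y| dy`.

By Jensen's inequality it remains to bound
`|y| ^ (-a q) ∫_{|x| ≤ |y|} |x| ^ b |x - y| ^ ((1 - n) q) dx` uniformly in `y`. It is independent of
`|y|` by scaling, and the singularities at `0` and at `y` are integrable because `b > -n` and
`q (n - 1) < n`.
-/

namespace KornHardy

open Real Set Metric Module
open scoped NNReal ENNReal RealInnerProductSpace

section IntegralOperators

variable {α β : Type*} [MeasurableSpace α] [MeasurableSpace β]

lemma rpow_lintegral_le_measure_univ_mul (ν : Measure β) {q : ℝ} (hq : 1 ≤ q) {f : β → ℝ≥0∞}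
    (hf : AEMeasurable f ν) :
    (∫⁻ y, f y ∂ν) ^ q ≤ ν univ ^ (q - 1) * ∫⁻ y, f y ^ q ∂ν := by
  have hq0 : 0 < q := by linarith
  have h := eLpNorm'_le_eLpNorm'_mul_rpow_measure_univ one_pos hq hf.aestronglyMeasurable
  simp only [eLpNorm'_eq_lintegral_enorm, enorm_eq_self, ENNReal.rpow_one, div_one] at h
  have hexp : (1 - 1 / q) * q = q - 1 := by field_simp
  calc (∫⁻ y, f y ∂ν) ^ q
      ≤ ((∫⁻ y, f y ^ q ∂ν) ^ (1 / q) * ν univ ^ (1 - 1 / q)) ^ q :=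
        ENNReal.rpow_le_rpow h hq0.le
    _ = ν univ ^ (q - 1) * ∫⁻ y, f y ^ q ∂ν := by
        rw [ENNReal.mul_rpow_of_nonneg _ _ hq0.le, ← ENNReal.rpow_mul, ← ENNReal.rpow_mul,
          one_div_mul_cancel hq0.ne', ENNReal.rpow_one, hexp, mul_comm]

lemma lintegral_rpow_lintegral_le {μ : Measure α} {ν : Measure β} [SFinite μ] [SFinite ν]
    {q : ℝ} (hq : 1 ≤ q) {K : α → β → ℝ≥0∞} (hK : Measurable (Function.uncurry K)) {D : ℝ≥0∞}
    (hD : ∀ᵐ y ∂ν, ∫⁻ x, K x y ^ q ∂μ ≤ D) :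
    ∫⁻ x, (∫⁻ y, K x y ∂ν) ^ q ∂μ ≤ D * ν univ ^ q := by
  have hKq : Measurable (Function.uncurry fun x y => K x y ^ q) := hK.pow_const q
  have hint : Measurable fun x => ∫⁻ y, K x y ^ q ∂ν := hKq.lintegral_prod_right'
  calc ∫⁻ x, (∫⁻ y, K x y ∂ν) ^ q ∂μ
      ≤ ∫⁻ x, ν univ ^ (q - 1) * ∫⁻ y, K x y ^ q ∂ν ∂μ := lintegral_mono fun x =>
        rpow_lintegral_le_measure_univ_mul ν hq hK.of_uncurry_left.aemeasurable
    _ = ν univ ^ (q - 1) * ∫⁻ y, ∫⁻ x, K x y ^ q ∂μ ∂ν := by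
        rw [lintegral_const_mul _ hint, lintegral_lintegral_swap hKq.aemeasurable]
    _ ≤ ν univ ^ (q - 1) * ∫⁻ _, D ∂ν := by
        gcongr 1
        exact lintegral_mono_ae hD
    _ = D * ν univ ^ q := by
        have hpow : ν univ ^ (q - 1) * ν univ = ν univ ^ q := by
          simpa using (ENNReal.rpow_add_of_nonneg (x := ν univ) (q - 1) 1 (by linarith)
            zero_le_one).symm
        rw [lintegral_const, mul_left_comm, hpow]

end IntegralOperators

lemma exists_enorm_le_mul_lintegral_enorm {V X : Type*} [NormedAddCommGroup V] [NormedSpace ℝ V]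
    [FiniteDimensional ℝ V] [TopologicalSpace X] [CompactSpace X] [MeasurableSpace X]
    [BorelSpace X] (σ : Measure X) [IsFiniteMeasure σ] [σ.IsOpenPosMeasure] {L : V →ₗ[ℝ] C(X, ℝ)}
    (hL : Function.Injective L) :
    ∃ C : ℝ≥0, ∀ v, ‖v‖ₑ ≤ C * ∫⁻ x, ‖L v x‖ₑ ∂σ := by
  let T : V →ₗ[ℝ] Lp ℝ 1 σ := (ContinuousMap.toLp 1 σ ℝ).toLinearMap ∘ₗ L
  have hT : Function.Injective T :=
    (ContinuousMap.toLp_injective (E := ℝ) (p := 1) (𝕜 := ℝ) σ).comp hL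
  obtain ⟨C, -, hC⟩ := T.injective_iff_antilipschitz.1 hT
  refine ⟨C, fun v => ?_⟩
  have hTv : ‖T v‖ₑ = ∫⁻ x, ‖L v x‖ₑ ∂σ := by
    rw [Lp.enorm_def, eLpNorm_one_eq_lintegral_enorm]
    refine lintegral_congr_ae ?_
    filter_upwards [ContinuousMap.coeFn_toLp (p := 1) (𝕜 := ℝ) σ (L v)] with x hx
    exact congrArg _ hx
  simpa [edist_zero_right, hTv] using hC v 0

lemma rpow_le_two_rpow_abs_mul_rpow {r t : ℝ} (s : ℝ) (ht : 0 < t) (hlow : t / 2 ≤ r)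
    (hup : r ≤ 2 * t) : r ^ s ≤ 2 ^ |s| * t ^ s := by
  have hr : 0 < r := by linarith
  rcases le_total 0 s with hs | hs
  · rw [abs_of_nonneg hs, ← mul_rpow two_pos.le ht.le]
    exact rpow_le_rpow hr.le hup hs
  · rw [abs_of_nonpos hs, rpow_neg two_pos.le, ← inv_rpow two_pos.le,
      ← mul_rpow (by positivity) ht.le]
    exact rpow_le_rpow_of_nonpos (by positivity) (by linarith) hs

lemma norm_rpow_mul_norm_sub_rpow_le {E : Type*} [NormedAddCommGroup E] (b s : ℝ) {x y : E}
    (hy : y ≠ 0) (hxy : ‖x‖ ≤ ‖y‖) :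
    ‖x‖ ^ b * ‖x - y‖ ^ s ≤
      2 ^ |b| * ‖y‖ ^ b * ‖x - y‖ ^ s + 2 ^ |s| * ‖y‖ ^ s * ‖x‖ ^ b := by
  have hy0 : 0 < ‖y‖ := norm_pos_iff.2 hy
  -- Only one factor is singular at a time: `‖x‖ ≈ ‖y‖` far from `0`, `‖x - y‖ ≈ ‖y‖` near `0`.
  rcases le_total (‖y‖ / 2) ‖x‖ with hfar | hnear
  · have hx : ‖x‖ ^ b ≤ 2 ^ |b| * ‖y‖ ^ b :=
      rpow_le_two_rpow_abs_mul_rpow b hy0 hfar (by linarith)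
    exact le_add_of_le_of_nonneg (by gcongr) (by positivity)
  · have hsub : ‖x - y‖ ^ s ≤ 2 ^ |s| * ‖y‖ ^ s :=
      rpow_le_two_rpow_abs_mul_rpow s hy0 (by linarith [norm_sub_norm_le y x, norm_sub_rev x y])
        (by linarith [norm_sub_le x y])
    exact le_add_of_nonneg_of_le (by positivity) (by rw [mul_comm]; gcongr)

lemma lintegral_Ioc_rpow {p R : ℝ} (hp : -1 < p) (hR : 0 ≤ R) :
    ∫⁻ r in Ioc 0 R, ENNReal.ofReal (r ^ p) = ENNReal.ofReal (R ^ (p + 1) / (p + 1)) := by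
  have hint : IntervalIntegrable (fun r : ℝ => r ^ p) volume 0 R :=
    intervalIntegral.intervalIntegrable_rpow' hp
  have hnonneg : 0 ≤ᵐ[volume.restrict (Ioc 0 R)] fun r : ℝ => r ^ p := by
    filter_upwards [ae_restrict_mem measurableSet_Ioc] with r hr
    exact rpow_nonneg hr.1.le _
  rw [← ofReal_integral_eq_lintegral_ofReal hint.1 hnonneg, ← intervalIntegral.integral_of_le hR,
    integral_rpow (.inl hp), zero_rpow (by linarith), sub_zero]

section RadialIntegrals

variable {E : Type*} [NormedAddCommGroup E] [NormedSpace ℝ E] [FiniteDimensional ℝ E]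
  [Nontrivial E] [MeasurableSpace E] [BorelSpace E] (μ : Measure E) [μ.IsAddHaarMeasure]

lemma lintegral_eq_lintegral_toSphere {f : E → ℝ≥0∞} (hf : Measurable f) :
    ∫⁻ z, f z ∂μ = ∫⁻ e : sphere (0 : E) 1, ∫⁻ r in Ioi (0 : ℝ),
      ENNReal.ofReal (r ^ (finrank ℝ E - 1)) * f (r • (e : E)) ∂volume ∂μ.toSphere := by
  have hpolar : MeasurePreserving (homeomorphUnitSphereProd E).toMeasurableEquiv.symm
      (μ.toSphere.prod (.volumeIoiPow (finrank ℝ E - 1))) (μ.comap (↑)) :=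
    μ.measurePreserving_homeomorphUnitSphereProd.symm
      (homeomorphUnitSphereProd E).toMeasurableEquiv
  calc ∫⁻ z, f z ∂μ
      = ∫⁻ z : ({0}ᶜ : Set E), f z ∂μ.comap (↑) := by
        rw [lintegral_subtype_comap (measurableSet_singleton _).compl, restrict_compl_singleton]
    _ = ∫⁻ p, f (p.2.1 • (p.1 : E)) ∂μ.toSphere.prod (.volumeIoiPow (finrank ℝ E - 1)) :=
        (hpolar.lintegral_comp (hf.comp measurable_subtype_coe)).symm
    _ = ∫⁻ e, ∫⁻ r, f (r.1 • (e : E)) ∂.volumeIoiPow (finrank ℝ E - 1) ∂μ.toSphere :=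
        lintegral_prod _ (by fun_prop)
    _ = _ := by
        refine lintegral_congr fun e => ?_
        rw [Measure.volumeIoiPow,
          lintegral_withDensity_eq_lintegral_mul _ (by fun_prop) (by fun_prop)]
        exact lintegral_subtype_comap measurableSet_Ioi fun r : ℝ =>
          ENNReal.ofReal (r ^ (finrank ℝ E - 1)) * f (r • (e : E))

lemma lintegral_fun_norm {f : ℝ → ℝ≥0∞} (hf : Measurable f) :
    ∫⁻ z, f ‖z‖ ∂μ = μ.toSphere univ *
      ∫⁻ r in Ioi (0 : ℝ), ENNReal.ofReal (r ^ (finrank ℝ E - 1)) * f r := by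
  have hradial : ∀ e : sphere (0 : E) 1, ∀ r ∈ Ioi (0 : ℝ),
      ENNReal.ofReal (r ^ (finrank ℝ E - 1)) * f ‖r • (e : E)‖ =
        ENNReal.ofReal (r ^ (finrank ℝ E - 1)) * f r := by
    intro e r (hr : 0 < r)
    simp [norm_smul, abs_of_pos hr]
  rw [lintegral_eq_lintegral_toSphere μ (f := fun z => f ‖z‖) (by fun_prop)]
  simp_rw [setLIntegral_congr_fun measurableSet_Ioi (hradial _)]
  rw [lintegral_const, mul_comm]

lemma setLIntegral_closedBall_norm_rpow {s R : ℝ} (hs : -finrank ℝ E < s) (hR : 0 ≤ R) :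
    ∫⁻ z in closedBall (0 : E) R, ENNReal.ofReal (‖z‖ ^ s) ∂μ =
      μ.toSphere univ * ENNReal.ofReal (R ^ (finrank ℝ E + s) / (finrank ℝ E + s)) := by
  have hpow : ∀ r ∈ Ioc 0 R, ENNReal.ofReal (r ^ (finrank ℝ E - 1)) * ENNReal.ofReal (r ^ s) =
      ENNReal.ofReal (r ^ (finrank ℝ E + s - 1)) := by
    intro r hr
    rw [← ENNReal.ofReal_mul (pow_nonneg hr.1.le _), ← rpow_natCast, Nat.cast_pred finrank_pos,
      ← rpow_add hr.1, sub_add_eq_add_sub]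
  have hball : (closedBall (0 : E) R).indicator (fun z => ENNReal.ofReal (‖z‖ ^ s)) =
      fun z => (Iic R).indicator (fun r => ENNReal.ofReal (r ^ s)) ‖z‖ := by
    ext z
    simp [indicator]
  rw [← lintegral_indicator measurableSet_closedBall, hball,
    lintegral_fun_norm μ (Measurable.indicator (by fun_prop) measurableSet_Iic)]
  simp_rw [← indicator_mul_right (Iic R) (fun r : ℝ => ENNReal.ofReal (r ^ (finrank ℝ E - 1)))]
  rw [setLIntegral_indicator measurableSet_Iic, inter_comm, Ioi_inter_Iic,
    setLIntegral_congr_fun measurableSet_Ioc hpow, lintegral_Ioc_rpow (by linarith) hR,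
    sub_add_cancel]

lemma setLIntegral_closedBall_norm_sub_rpow_le {s : ℝ} (hs : -finrank ℝ E < s) (y : E) :
    ∫⁻ x in closedBall (0 : E) ‖y‖, ENNReal.ofReal (‖x - y‖ ^ s) ∂μ ≤
      μ.toSphere univ * ENNReal.ofReal ((2 * ‖y‖) ^ (finrank ℝ E + s) / (finrank ℝ E + s)) := by
  set g : E → ℝ≥0∞ := (closedBall 0 (2 * ‖y‖)).indicator fun z => ENNReal.ofReal (‖z‖ ^ s)
  have hsub : ∀ x ∈ closedBall (0 : E) ‖y‖, ENNReal.ofReal (‖x - y‖ ^ s) = g (x - y) := by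
    intro x hx
    rw [mem_closedBall_zero_iff] at hx
    have hxy : x - y ∈ closedBall (0 : E) (2 * ‖y‖) :=
      mem_closedBall_zero_iff.2 (by linarith [norm_sub_le x y])
    exact (indicator_of_mem hxy fun z => ENNReal.ofReal (‖z‖ ^ s)).symm
  calc ∫⁻ x in closedBall (0 : E) ‖y‖, ENNReal.ofReal (‖x - y‖ ^ s) ∂μ
      = ∫⁻ x in closedBall (0 : E) ‖y‖, g (x - y) ∂μ :=
        setLIntegral_congr_fun measurableSet_closedBall hsub
    _ ≤ ∫⁻ x, g (x - y) ∂μ := setLIntegral_le_lintegral _ _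
    _ = ∫⁻ z in closedBall (0 : E) (2 * ‖y‖), ENNReal.ofReal (‖z‖ ^ s) ∂μ := by
        rw [lintegral_sub_right_eq_self g y, lintegral_indicator measurableSet_closedBall]
    _ = _ := setLIntegral_closedBall_norm_rpow μ hs (by positivity)

lemma exists_setLIntegral_closedBall_norm_rpow_mul_norm_sub_rpow_le {b s : ℝ}
    (hb : -finrank ℝ E < b) (hs : -finrank ℝ E < s) :
    ∃ D : ℝ≥0, ∀ y : E, y ≠ 0 →
      ∫⁻ x in closedBall (0 : E) ‖y‖, ENNReal.ofReal (‖x‖ ^ b * ‖x - y‖ ^ s) ∂μ ≤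
        D * ENNReal.ofReal (‖y‖ ^ (finrank ℝ E + b + s)) := by
  set n : ℝ := (finrank ℝ E : ℝ)
  have hnb : 0 < n + b := by linarith
  have hns : 0 < n + s := by linarith
  set c : ℝ := 2 ^ |b| * (2 ^ (n + s) / (n + s)) + 2 ^ |s| / (n + b)
  refine ⟨(μ.toSphere univ * ENNReal.ofReal c).toNNReal, fun y hy => ?_⟩
  have hy0 : 0 < ‖y‖ := norm_pos_iff.2 hy
  have hsum : 2 ^ |b| * ‖y‖ ^ b * ((2 * ‖y‖) ^ (n + s) / (n + s)) +
      2 ^ |s| * ‖y‖ ^ s * (‖y‖ ^ (n + b) / (n + b)) = c * ‖y‖ ^ (n + b + s) := by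
    rw [mul_rpow two_pos.le hy0.le]
    simp only [c, rpow_add hy0]
    ring
  calc ∫⁻ x in closedBall (0 : E) ‖y‖, ENNReal.ofReal (‖x‖ ^ b * ‖x - y‖ ^ s) ∂μ
      ≤ ∫⁻ x in closedBall (0 : E) ‖y‖,
          (ENNReal.ofReal (2 ^ |b| * ‖y‖ ^ b) * ENNReal.ofReal (‖x - y‖ ^ s) +
            ENNReal.ofReal (2 ^ |s| * ‖y‖ ^ s) * ENNReal.ofReal (‖x‖ ^ b)) ∂μ := by
        refine setLIntegral_mono' measurableSet_closedBall fun x hx => ?_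
        rw [← ENNReal.ofReal_mul (by positivity), ← ENNReal.ofReal_mul (by positivity),
          ← ENNReal.ofReal_add (by positivity) (by positivity)]
        exact ENNReal.ofReal_le_ofReal
          (norm_rpow_mul_norm_sub_rpow_le b s hy (mem_closedBall_zero_iff.1 hx))
    _ ≤ ENNReal.ofReal (2 ^ |b| * ‖y‖ ^ b) *
            (μ.toSphere univ * ENNReal.ofReal ((2 * ‖y‖) ^ (n + s) / (n + s))) +
          ENNReal.ofReal (2 ^ |s| * ‖y‖ ^ s) *
            (μ.toSphere univ * ENNReal.ofReal (‖y‖ ^ (n + b) / (n + b))) := by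
        rw [lintegral_add_left (by fun_prop), lintegral_const_mul _ (by fun_prop),
          lintegral_const_mul _ (by fun_prop), setLIntegral_closedBall_norm_rpow μ hb hy0.le]
        gcongr
        exact setLIntegral_closedBall_norm_sub_rpow_le μ hs y
    _ = μ.toSphere univ * ENNReal.ofReal c * ENNReal.ofReal (‖y‖ ^ (n + b + s)) := by
        rw [mul_left_comm, mul_left_comm (ENNReal.ofReal (2 ^ |s| * ‖y‖ ^ s)), ← mul_add,
          ← ENNReal.ofReal_mul (by positivity), ← ENNReal.ofReal_mul (by positivity),
          ← ENNReal.ofReal_add (by positivity) (by positivity), hsum,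
          ENNReal.ofReal_mul (by positivity), mul_assoc]
    _ = _ := by
        rw [ENNReal.coe_toNNReal (ENNReal.mul_ne_top (measure_ne_top _ _) ENNReal.ofReal_ne_top)]

lemma integrable_norm_rpow_mul_norm {F : Type*} [NormedAddCommGroup F] {s : ℝ}
    (hs : -finrank ℝ E < s) {f : E → F} (hf : Continuous f) (hfs : HasCompactSupport f) :
    Integrable (fun x => ‖x‖ ^ s * ‖f x‖) μ := by
  have hloc : LocallyIntegrable (fun x : E => ‖x‖ ^ s) μ :=
    locallyIntegrable_of_norm_le_rpow (C := 1) (α := -s) finrank_pos (by linarith)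
      (.of_forall fun x => by simp [abs_of_nonneg, rpow_nonneg])
      (Measurable.aestronglyMeasurable (by fun_prop))
  exact hloc.integrable_smul_right_of_hasCompactSupport hf.norm hfs.norm

lemma lintegral_ofReal_norm_rpow_mul_enorm {F : Type*} [NormedAddCommGroup F] {s : ℝ}
    (hs : -finrank ℝ E < s) {f : E → F} (hf : Continuous f) (hfs : HasCompactSupport f) :
    ∫⁻ x, ENNReal.ofReal (‖x‖ ^ s) * ‖f x‖ₑ ∂μ = ENNReal.ofReal (∫ x, ‖x‖ ^ s * ‖f x‖ ∂μ) := by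
  rw [ofReal_integral_eq_lintegral_ofReal (integrable_norm_rpow_mul_norm μ hs hf hfs)
    (.of_forall fun x => by positivity)]
  refine lintegral_congr fun x => ?_
  rw [ENNReal.ofReal_mul (by positivity), ofReal_norm]

end RadialIntegrals

section SymmGrad

variable {E : Type*} [NormedAddCommGroup E] [InnerProductSpace ℝ E] [CompleteSpace E]
  {u : E → E}

/-- The symmetrized gradient `(Du(x) + Du(x)*) / 2` of a vector field on a Hilbert space, as the
self-adjoint part of the Fréchet derivative. -/
noncomputable def symmGrad (u : E → E) (x : E) : E →L[ℝ] E :=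
  selfAdjointPart ℝ (fderiv ℝ u x)

lemma inner_symmGrad_apply_self (u : E → E) (x e : E) :
    ⟪symmGrad u x e, e⟫ = ⟪fderiv ℝ u x e, e⟫ := by
  have hadj : ⟪star (fderiv ℝ u x) e, e⟫ = ⟪fderiv ℝ u x e, e⟫ := by
    rw [ContinuousLinearMap.star_eq_adjoint, ContinuousLinearMap.adjoint_inner_left,
      real_inner_comm]
  rw [symmGrad, selfAdjointPart_apply_coe, smul_apply,
    add_apply, inner_smul_left, inner_add_left, hadj]
  simp [← two_mul]

lemma continuous_symmGrad (hu : ContDiff ℝ 1 u) : Continuous (symmGrad u) := by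
  have := hu.continuous_fderiv one_ne_zero
  unfold symmGrad
  fun_prop

lemma hasCompactSupport_symmGrad (hs : HasCompactSupport u) : HasCompactSupport (symmGrad u) :=
  (hs.fderiv ℝ).comp_left (g := fun A : E →L[ℝ] E => (selfAdjointPart ℝ A : E →L[ℝ] E)) (by simp)

lemma hasDerivAt_inner_line {x e : E} {t : ℝ} (hu : DifferentiableAt ℝ u (x + t • e)) :
    HasDerivAt (fun t : ℝ => ⟪u (x + t • e), e⟫) ⟪symmGrad u (x + t • e) e, e⟫ t := by
  have hline : HasDerivAt (fun t : ℝ => x + t • e) e t := by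
    simpa using ((hasDerivAt_id t).smul_const e).const_add x
  have hcomp := hu.hasFDerivAt.comp_hasDerivAt t hline
  simpa [inner_symmGrad_apply_self] using hcomp.inner ℝ (hasDerivAt_const t e)

lemma enorm_inner_le_lintegral_ray (hu : ContDiff ℝ 1 u) (hs : HasCompactSupport u) (x : E)
    {e : E} (he : ‖e‖ = 1) :
    ‖⟪u x, e⟫‖ₑ ≤ ∫⁻ r in Ioi (0 : ℝ), ‖symmGrad u (x + r • e)‖ₑ := by
  set φ : ℝ → ℝ := fun t => ⟪u (x + t • e), e⟫
  have hline : Topology.IsClosedEmbedding fun t : ℝ => x + t • e :=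
    (Isometry.of_dist_eq fun s t => by
      simp [dist_eq_norm, ← sub_smul, norm_smul, he]).isClosedEmbedding
  have hφs : HasCompactSupport φ :=
    (hs.comp_isClosedEmbedding hline).comp_left (g := fun v => ⟪v, e⟫) (inner_zero_left e)
  have hφ : ContDiff ℝ 1 φ :=
    (hu.comp (by fun_prop : ContDiff ℝ 1 fun t : ℝ => x + t • e)).inner ℝ contDiff_const
  have hderiv : ∀ t, ‖deriv φ t‖ ≤ ‖symmGrad u (x + t • e)‖ := fun t => by
    rw [(hasDerivAt_inner_line (hu.differentiable one_ne_zero _)).deriv]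
    refine (norm_inner_le_norm _ _).trans ?_
    simpa [he] using (symmGrad u (x + t • e)).le_opNorm e
  calc ‖⟪u x, e⟫‖ₑ = ‖∫ t in Ioi (0 : ℝ), deriv φ t‖ₑ := by
        simp [hφs.integral_Ioi_deriv_eq hφ 0, φ]
    _ ≤ ∫⁻ t in Ioi (0 : ℝ), ‖deriv φ t‖ₑ := enorm_integral_le_lintegral_enorm _
    _ ≤ ∫⁻ t in Ioi (0 : ℝ), ‖symmGrad u (x + t • e)‖ₑ :=
        lintegral_mono fun t => enorm_le_iff_norm_le.2 (hderiv t)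

end SymmGrad

lemma exists_enorm_le_mul_lintegral_enorm_inner {E : Type*} [NormedAddCommGroup E]
    [InnerProductSpace ℝ E] [FiniteDimensional ℝ E] [MeasurableSpace E] [BorelSpace E]
    (σ : Measure (sphere (0 : E) 1)) [IsFiniteMeasure σ] [σ.IsOpenPosMeasure] :
    ∃ C : ℝ≥0, ∀ v : E, ‖v‖ₑ ≤ C * ∫⁻ e, ‖⟪v, (e : E)⟫‖ₑ ∂σ := by
  let L : E →ₗ[ℝ] C(sphere (0 : E) 1, ℝ) :=
    { toFun := fun v => ⟨fun e => ⟪v, (e : E)⟫, by fun_prop⟩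
      map_add' := fun v w => ContinuousMap.ext fun e => inner_add_left v w (e : E)
      map_smul' := fun c v => ContinuousMap.ext fun e => real_inner_smul_left v (e : E) c }
  have hL : Function.Injective L := by
    refine (injective_iff_map_eq_zero L).2 fun v hv => ?_
    by_contra hv0
    have he : ‖v‖⁻¹ • v ∈ sphere (0 : E) 1 := by
      rw [mem_sphere_zero_iff_norm, norm_smul, norm_inv, norm_norm,
        inv_mul_cancel₀ (norm_ne_zero_iff.2 hv0)]
    have h := DFunLike.congr_fun hv ⟨‖v‖⁻¹ • v, he⟩
    simp [L, inner_smul_right, hv0] at h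
  exact exists_enorm_le_mul_lintegral_enorm σ hL

section ExteriorKernel

section Normed

variable {E : Type*} [NormedAddCommGroup E] [NormedSpace ℝ E]

/-- The kernel `|x - y| ^ (1 - n)` of the Riesz potential of order one in dimension `n`, restricted
to the points `y` that are no closer to the origin than `x`. -/
noncomputable def exteriorKernel (x y : E) : ℝ≥0∞ :=
  if ‖x‖ ≤ ‖y‖ then ENNReal.ofReal (‖x - y‖ ^ (1 - finrank ℝ E : ℝ)) else 0

lemma measurable_exteriorKernel [MeasurableSpace E] [BorelSpace E]
    [SecondCountableTopology E] :
    Measurable (Function.uncurry (exteriorKernel (E := E))) :=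
  Measurable.ite (measurableSet_le (by fun_prop) (by fun_prop)) (by fun_prop) measurable_const

end Normed

variable {E : Type*} [NormedAddCommGroup E] [InnerProductSpace ℝ E]

lemma norm_le_norm_add_smul {x e : E} {r : ℝ} (hr : 0 ≤ r) (hxe : 0 ≤ ⟪x, e⟫) :
    ‖x‖ ≤ ‖x + r • e‖ := by
  rw [← sq_le_sq₀ (norm_nonneg _) (norm_nonneg _), norm_add_sq_real, inner_smul_right]
  nlinarith [mul_nonneg hr hxe, sq_nonneg ‖r • e‖]

variable [FiniteDimensional ℝ E] [Nontrivial E]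

lemma ofReal_pow_mul_exteriorKernel_add_smul {x e : E} (he : ‖e‖ = 1) (hxe : 0 ≤ ⟪x, e⟫) {r : ℝ}
    (hr : 0 < r) :
    ENNReal.ofReal (r ^ (finrank ℝ E - 1)) * exteriorKernel x (x + r • e) = 1 := by
  have hnorm : ‖x - (x + r • e)‖ = r := by simp [norm_smul, he, abs_of_pos hr]
  rw [exteriorKernel, if_pos (norm_le_norm_add_smul hr.le hxe), hnorm,
    ← ENNReal.ofReal_mul (by positivity), ← rpow_natCast, Nat.cast_pred finrank_pos, ← rpow_add hr]
  simp

variable {u : E → E}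

lemma enorm_inner_le_lintegral_exteriorKernel_ray (hu : ContDiff ℝ 1 u)
    (hs : HasCompactSupport u) {x e : E} (he : ‖e‖ = 1) (hxe : 0 ≤ ⟪x, e⟫) :
    ‖⟪u x, e⟫‖ₑ ≤ ∫⁻ r in Ioi (0 : ℝ), ENNReal.ofReal (r ^ (finrank ℝ E - 1)) *
      (exteriorKernel x (x + r • e) * ‖symmGrad u (x + r • e)‖ₑ) := by
  refine (enorm_inner_le_lintegral_ray hu hs x he).trans_eq
    (setLIntegral_congr_fun measurableSet_Ioi fun r hr => ?_)
  rw [← mul_assoc, ofReal_pow_mul_exteriorKernel_add_smul he hxe hr, one_mul]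

lemma enorm_inner_le_lintegral_exteriorKernel_line (hu : ContDiff ℝ 1 u)
    (hs : HasCompactSupport u) (x : E) {e : E} (he : ‖e‖ = 1) :
    ‖⟪u x, e⟫‖ₑ ≤ ∫⁻ r in Ioi (0 : ℝ), ENNReal.ofReal (r ^ (finrank ℝ E - 1)) *
      (exteriorKernel x (x + r • e) * ‖symmGrad u (x + r • e)‖ₑ +
        exteriorKernel x (x - r • e) * ‖symmGrad u (x - r • e)‖ₑ) := by
  rcases le_total 0 ⟪x, e⟫ with hxe | hxe
  · refine (enorm_inner_le_lintegral_exteriorKernel_ray hu hs he hxe).trans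
      (lintegral_mono fun r => ?_)
    gcongr
    exact le_self_add
  · have hneg := enorm_inner_le_lintegral_exteriorKernel_ray hu hs (x := x) (e := -e)
      (by simpa using he) (by simpa using hxe)
    simp only [inner_neg_right, enorm_neg, smul_neg, ← sub_eq_add_neg] at hneg
    refine hneg.trans (lintegral_mono fun r => ?_)
    gcongr
    exact le_add_self

variable [MeasurableSpace E] [BorelSpace E] (μ : Measure E) [μ.IsAddHaarMeasure]

lemma exists_enorm_le_lintegral_exteriorKernel :
    ∃ C : ℝ≥0, ∀ u : E → E, ContDiff ℝ 1 u → HasCompactSupport u → ∀ x,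
      ‖u x‖ₑ ≤ C * ∫⁻ y, exteriorKernel x y * ‖symmGrad u y‖ₑ ∂μ := by
  obtain ⟨C, hC⟩ := exists_enorm_le_mul_lintegral_enorm_inner μ.toSphere
  refine ⟨C * 2, fun u hu hs x => ?_⟩
  set g : E → ℝ≥0∞ := fun y => exteriorKernel x y * ‖symmGrad u y‖ₑ
  have hg : Measurable g :=
    measurable_exteriorKernel.of_uncurry_left.mul (continuous_symmGrad hu).enorm.measurable
  calc ‖u x‖ₑ ≤ C * ∫⁻ e, ‖⟪u x, (e : E)⟫‖ₑ ∂μ.toSphere := hC (u x)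
    _ ≤ C * ∫⁻ e : sphere (0 : E) 1, ∫⁻ r in Ioi (0 : ℝ), ENNReal.ofReal (r ^ (finrank ℝ E - 1)) *
          (g (x + r • (e : E)) + g (x - r • (e : E))) ∂volume ∂μ.toSphere := by
        gcongr with e
        exact enorm_inner_le_lintegral_exteriorKernel_line hu hs x (norm_eq_of_mem_sphere e)
    _ = C * ∫⁻ z, (g (x + z) + g (x - z)) ∂μ := by
        rw [lintegral_eq_lintegral_toSphere μ (f := fun z => g (x + z) + g (x - z)) (by fun_prop)]
    _ = ↑(C * 2) * ∫⁻ y, g y ∂μ := by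
        rw [lintegral_add_left (by fun_prop), lintegral_add_left_eq_self g,
          lintegral_sub_left_eq_self g, ← two_mul, ENNReal.coe_mul, ENNReal.coe_two, mul_assoc]

lemma exists_lintegral_norm_rpow_mul_exteriorKernel_rpow_le {q a b : ℝ} (hq : 0 < q)
    (hqn : q * (finrank ℝ E - 1) < finrank ℝ E) (hb : -finrank ℝ E < b)
    (hab : finrank ℝ E + b = q * (finrank ℝ E - 1 + a)) :
    ∃ D : ℝ≥0, ∀ y : E, y ≠ 0 →
      ∫⁻ x, ENNReal.ofReal (‖x‖ ^ b) *
        (exteriorKernel x y * ENNReal.ofReal (‖y‖ ^ (-a))) ^ q ∂μ ≤ D := by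
  set s : ℝ := (1 - finrank ℝ E) * q
  obtain ⟨D, hD⟩ := exists_setLIntegral_closedBall_norm_rpow_mul_norm_sub_rpow_le μ (s := s) hb
    (by simp only [s]; linarith)
  refine ⟨D, fun y hy => ?_⟩
  have hy0 : 0 < ‖y‖ := norm_pos_iff.2 hy
  have hkernel : ∀ x : E, ENNReal.ofReal (‖x‖ ^ b) *
      (exteriorKernel x y * ENNReal.ofReal (‖y‖ ^ (-a))) ^ q =
        (closedBall (0 : E) ‖y‖).indicator
          (fun x => ENNReal.ofReal (‖x‖ ^ b * ‖x - y‖ ^ s)) x *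
            ENNReal.ofReal (‖y‖ ^ (-a * q)) := by
    intro x
    by_cases hxy : ‖x‖ ≤ ‖y‖
    · rw [indicator_of_mem (mem_closedBall_zero_iff.2 hxy), exteriorKernel, if_pos hxy,
        ENNReal.mul_rpow_of_nonneg _ _ hq.le, ENNReal.ofReal_rpow_of_nonneg (by positivity) hq.le,
        ENNReal.ofReal_rpow_of_nonneg (by positivity) hq.le, ← rpow_mul (norm_nonneg _),
        ← rpow_mul (norm_nonneg _), ENNReal.ofReal_mul (by positivity), mul_assoc]
    · rw [indicator_of_notMem (by simpa using hxy), exteriorKernel, if_neg hxy, zero_mul, zero_mul,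
        ENNReal.zero_rpow_of_pos hq, mul_zero]
  have hcancel : ENNReal.ofReal (‖y‖ ^ (finrank ℝ E + b + s)) *
      ENNReal.ofReal (‖y‖ ^ (-a * q)) = 1 := by
    rw [← ENNReal.ofReal_mul (by positivity), ← rpow_add hy0,
      show finrank ℝ E + b + s + -a * q = 0 by simp only [s]; linarith, rpow_zero,
      ENNReal.ofReal_one]
  simp_rw [hkernel]
  rw [lintegral_mul_const _ (Measurable.indicator (by fun_prop) measurableSet_closedBall),
    lintegral_indicator measurableSet_closedBall]
  calc _ ≤ D * ENNReal.ofReal (‖y‖ ^ (finrank ℝ E + b + s)) * ENNReal.ofReal (‖y‖ ^ (-a * q)) := by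
        gcongr
        exact hD y hy
    _ = D := by rw [mul_assoc, hcancel, mul_one]

end ExteriorKernel

section WeightedIntegrals

variable {E : Type*} [NormedAddCommGroup E] [MeasurableSpace E] [OpensMeasurableSpace E]
  (μ : Measure E)

lemma lintegral_withDensity_norm_rpow_mul [NullSingletonClass μ] (a : ℝ) {f g : E → ℝ≥0∞}
    (hf : Measurable f) (hg : Measurable g) :
    ∫⁻ y, f y * ENNReal.ofReal (‖y‖ ^ (-a)) ∂μ.withDensity (fun y => ENNReal.ofReal (‖y‖ ^ a) * g y)
      = ∫⁻ y, f y * g y ∂μ := by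
  rw [lintegral_withDensity_eq_lintegral_mul μ (by fun_prop) (by fun_prop)]
  refine lintegral_congr_ae ?_
  filter_upwards [compl_mem_ae_iff.2 (measure_singleton (μ := μ) (0 : E))] with y hy
  have hcancel : ENNReal.ofReal (‖y‖ ^ a) * ENNReal.ofReal (‖y‖ ^ (-a)) = 1 := by
    rw [← ENNReal.ofReal_mul (by positivity), ← rpow_add (norm_pos_iff.2 hy), add_neg_cancel,
      rpow_zero, ENNReal.ofReal_one]
  calc ENNReal.ofReal (‖y‖ ^ a) * g y * (f y * ENNReal.ofReal (‖y‖ ^ (-a)))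
      = ENNReal.ofReal (‖y‖ ^ a) * ENNReal.ofReal (‖y‖ ^ (-a)) * (f y * g y) := by ring
    _ = f y * g y := by rw [hcancel, one_mul]

lemma integral_norm_rpow_mul_norm_rpow {F : Type*} [NormedAddCommGroup F] [MeasurableSpace F]
    [OpensMeasurableSpace F] {f : E → F} (hf : Measurable f) (b : ℝ) {q : ℝ} (hq : 0 ≤ q) :
    ∫ x, ‖x‖ ^ b * ‖f x‖ ^ q ∂μ =
      (∫⁻ x, ENNReal.ofReal (‖x‖ ^ b) * ‖f x‖ₑ ^ q ∂μ).toReal := by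
  rw [integral_eq_lintegral_of_nonneg_ae (.of_forall fun x => by positivity)
    (Measurable.aestronglyMeasurable (by fun_prop))]
  congr 1
  refine lintegral_congr fun x => ?_
  rw [ENNReal.ofReal_mul (by positivity), ← ENNReal.ofReal_rpow_of_nonneg (norm_nonneg _) hq,
    ofReal_norm]

end WeightedIntegrals

lemma exists_lintegral_norm_rpow_mul_enorm_rpow_le {E : Type*} [NormedAddCommGroup E]
    [InnerProductSpace ℝ E] [FiniteDimensional ℝ E] [Nontrivial E] [MeasurableSpace E]
    [BorelSpace E] (μ : Measure E) [μ.IsAddHaarMeasure] {q a b : ℝ} (hq : 1 ≤ q)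
    (hqn : q * (finrank ℝ E - 1) < finrank ℝ E) (hb : -finrank ℝ E < b)
    (hab : finrank ℝ E + b = q * (finrank ℝ E - 1 + a)) :
    ∃ C : ℝ≥0, ∀ u : E → E, ContDiff ℝ 1 u → HasCompactSupport u →
      ∫⁻ x, ENNReal.ofReal (‖x‖ ^ b) * ‖u x‖ₑ ^ q ∂μ ≤
        C * (∫⁻ y, ENNReal.ofReal (‖y‖ ^ a) * ‖symmGrad u y‖ₑ ∂μ) ^ q := by
  have hq0 : 0 < q := by linarith
  obtain ⟨A, hA⟩ := exists_enorm_le_lintegral_exteriorKernel μ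
  obtain ⟨D, hD⟩ := exists_lintegral_norm_rpow_mul_exteriorKernel_rpow_le μ hq0 hqn hb hab
  refine ⟨A ^ q * D, fun u hu hs => ?_⟩
  have hgrad : Measurable fun y => ‖symmGrad u y‖ₑ := (continuous_symmGrad hu).enorm.measurable
  set ρ : Measure E := μ.withDensity fun x => ENNReal.ofReal (‖x‖ ^ b)
  set ν : Measure E := μ.withDensity fun y => ENNReal.ofReal (‖y‖ ^ a) * ‖symmGrad u y‖ₑ
  set K : E → E → ℝ≥0∞ := fun x y => exteriorKernel x y * ENNReal.ofReal (‖y‖ ^ (-a))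
  have hK : Measurable (Function.uncurry K) := measurable_exteriorKernel.mul (by fun_prop)
  have hpointwise : ∀ x, ‖u x‖ₑ ≤ A * ∫⁻ y, K x y ∂ν := fun x => by
    rw [lintegral_withDensity_norm_rpow_mul μ a measurable_exteriorKernel.of_uncurry_left hgrad]
    exact hA u hu hs x
  have hcolumn : ∀ᵐ y ∂ν, ∫⁻ x, K x y ^ q ∂ρ ≤ D := by
    refine (withDensity_absolutelyContinuous μ _).ae_le ?_
    filter_upwards [compl_mem_ae_iff.2 (measure_singleton (μ := μ) (0 : E))] with y hy
    rw [lintegral_withDensity_eq_lintegral_mul μ (by fun_prop)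
      (hK.of_uncurry_right.pow_const q)]
    exact hD y hy
  calc ∫⁻ x, ENNReal.ofReal (‖x‖ ^ b) * ‖u x‖ₑ ^ q ∂μ
      = ∫⁻ x, ‖u x‖ₑ ^ q ∂ρ :=
        (lintegral_withDensity_eq_lintegral_mul μ (by fun_prop)
          (hu.continuous.enorm.measurable.pow_const q)).symm
    _ ≤ ∫⁻ x, (A : ℝ≥0∞) ^ q * (∫⁻ y, K x y ∂ν) ^ q ∂ρ := lintegral_mono fun x => by
        rw [← ENNReal.mul_rpow_of_nonneg _ _ hq0.le]
        exact ENNReal.rpow_le_rpow (hpointwise x) hq0.le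
    _ = A ^ q * ∫⁻ x, (∫⁻ y, K x y ∂ν) ^ q ∂ρ :=
        lintegral_const_mul _ (hK.lintegral_prod_right'.pow_const q)
    _ ≤ A ^ q * (D * ν univ ^ q) := by
        gcongr
        exact lintegral_rpow_lintegral_le hq hK hcolumn
    _ = _ := by
        rw [withDensity_apply _ .univ, Measure.restrict_univ, ENNReal.coe_mul,
          ENNReal.coe_rpow_of_nonneg _ hq0.le, mul_assoc]

lemma norm_toEuclideanCLM_le_frobenius {n : Type*} [Fintype n] [DecidableEq n]
    (A : Matrix n n ℝ) : ‖Matrix.toEuclideanCLM (n := n) (𝕜 := ℝ) A‖ ≤ ‖A‖ := by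
  refine ContinuousLinearMap.opNorm_le_bound _ (norm_nonneg _) fun v => ?_
  have h := Matrix.frobenius_norm_mul A (Matrix.replicateCol Unit v.ofLp)
  rw [← Matrix.replicateCol_mulVec, Matrix.frobenius_norm_replicateCol,
    Matrix.frobenius_norm_replicateCol] at h
  exact h

lemma toEuclideanCLM_jacobian (u : Plane → Plane) (x : Plane) :
    Matrix.toEuclideanCLM (n := Fin 2) (𝕜 := ℝ) (jacobian u x) = fderiv ℝ u x := by
  ext v i
  rw [Matrix.ofLp_toEuclideanCLM]
  conv_rhs => rw [← (EuclideanSpace.basisFun (Fin 2) ℝ).sum_repr v]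
  simp [Matrix.mulVec, dotProduct, jacobian, mul_comm]

lemma toEuclideanCLM_Dsym (u : Plane → Plane) (x : Plane) :
    Matrix.toEuclideanCLM (n := Fin 2) (𝕜 := ℝ) (Dsym u x) = symmGrad u x := by
  rw [symmGrad, selfAdjointPart_apply_coe, ← toEuclideanCLM_jacobian, ← map_star, ← map_add,
    Dsym, ← Matrix.conjTranspose_eq_transpose_of_trivial]
  simp [Matrix.star_eq_conjTranspose]

lemma norm_symmGrad_le_norm_Dsym (u : Plane → Plane) (x : Plane) :
    ‖symmGrad u x‖ ≤ ‖Dsym u x‖ :=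
  toEuclideanCLM_Dsym u x ▸ norm_toEuclideanCLM_le_frobenius (Dsym u x)

lemma Dsym_eq_toEuclideanCLM_symm (u : Plane → Plane) :
    Dsym u = (Matrix.toEuclideanCLM (n := Fin 2) (𝕜 := ℝ)).symm ∘ symmGrad u :=
  funext fun x => ((Matrix.toEuclideanCLM (n := Fin 2) (𝕜 := ℝ)).symm_apply_eq.2
    (toEuclideanCLM_Dsym u x).symm).symm

lemma continuous_Dsym {u : Plane → Plane} (hu : ContDiff ℝ 1 u) : Continuous (Dsym u) := by
  rw [Dsym_eq_toEuclideanCLM_symm]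
  exact (LinearMap.continuous_of_finiteDimensional
    (Matrix.toEuclideanCLM (n := Fin 2) (𝕜 := ℝ)).symm.toAlgEquiv.toLinearMap).comp
      (continuous_symmGrad hu)

lemma hasCompactSupport_Dsym {u : Plane → Plane} (hs : HasCompactSupport u) :
    HasCompactSupport (Dsym u) := by
  rw [Dsym_eq_toEuclideanCLM_symm]
  exact (hasCompactSupport_symmGrad hs).comp_left (map_zero _)

lemma integral_norm_rpow_mul_norm_symmGrad_le {u : Plane → Plane} (hu : ContDiff ℝ 1 u)
    (hs : HasCompactSupport u) {a : ℝ} (ha : -2 < a) :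
    ∫ x, ‖x‖ ^ a * ‖symmGrad u x‖ ≤ ∫ x, ‖x‖ ^ a * ‖Dsym u x‖ := by
  have ha' : -(finrank ℝ Plane : ℝ) < a := by simpa using ha
  refine integral_mono
    (integrable_norm_rpow_mul_norm _ ha' (continuous_symmGrad hu) (hasCompactSupport_symmGrad hs))
    (integrable_norm_rpow_mul_norm _ ha' (continuous_Dsym hu) (hasCompactSupport_Dsym hs))
    fun x => ?_
  exact mul_le_mul_of_nonneg_left (norm_symmGrad_le_norm_Dsym u x) (by positivity)

end KornHardy

open KornHardy in
theorem theorem1_general {E : Type*} [NormedAddCommGroup E] [InnerProductSpace ℝ E]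
    [FiniteDimensional ℝ E] [Nontrivial E] [MeasurableSpace E] [BorelSpace E] (μ : Measure E)
    [μ.IsAddHaarMeasure] {q a b : ℝ} (hq : 1 ≤ q)
    (hqn : q * (Module.finrank ℝ E - 1) < Module.finrank ℝ E) (hb : -Module.finrank ℝ E < b)
    (hab : (Module.finrank ℝ E + b) / q = Module.finrank ℝ E - 1 + a) :
    ∃ C : ℝ, 0 < C ∧ ∀ u : E → E, ContDiff ℝ 1 u → HasCompactSupport u →
      (∫ x, ‖x‖ ^ b * ‖u x‖ ^ q ∂μ) ^ (1 / q) ≤ C * ∫ x, ‖x‖ ^ a * ‖symmGrad u x‖ ∂μ := by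
  have hq0 : 0 < q := by linarith
  have ha : -(Module.finrank ℝ E : ℝ) < a := by
    have : 0 < (Module.finrank ℝ E + b) / q := div_pos (by linarith) hq0
    linarith
  obtain ⟨C, hC⟩ := exists_lintegral_norm_rpow_mul_enorm_rpow_le μ hq hqn hb
    (by rw [← hab, mul_div_cancel₀ _ hq0.ne'])
  refine ⟨(C : ℝ) ^ (1 / q) + 1, by positivity, fun u hu hs => ?_⟩
  set R := ∫ x, ‖x‖ ^ a * ‖symmGrad u x‖ ∂μ
  have hR : 0 ≤ R := integral_nonneg fun x => by positivity
  have hbound := hC u hu hs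
  rw [lintegral_ofReal_norm_rpow_mul_enorm μ ha (continuous_symmGrad hu)
    (hasCompactSupport_symmGrad hs), ENNReal.ofReal_rpow_of_nonneg hR hq0.le,
    ← ENNReal.ofReal_coe_nnreal, ← ENNReal.ofReal_mul C.coe_nonneg] at hbound
  have hreal : ∫ x, ‖x‖ ^ b * ‖u x‖ ^ q ∂μ ≤ C * R ^ q := by
    rw [integral_norm_rpow_mul_norm_rpow μ hu.continuous.measurable b hq0.le]
    exact ENNReal.toReal_le_of_le_ofReal (by positivity) hbound
  calc (∫ x, ‖x‖ ^ b * ‖u x‖ ^ q ∂μ) ^ (1 / q)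
      ≤ (C * R ^ q) ^ (1 / q) :=
        Real.rpow_le_rpow (integral_nonneg fun x => by positivity) hreal (by positivity)
    _ = (C : ℝ) ^ (1 / q) * R := by
        rw [Real.mul_rpow C.coe_nonneg (by positivity), ← Real.rpow_mul hR,
          mul_one_div_cancel hq0.ne', Real.rpow_one]
    _ ≤ ((C : ℝ) ^ (1 / q) + 1) * R := by gcongr; linarith

theorem theorem1 (q a b : ℝ) (hq1 : 1 ≤ q) (hq2 : q < 2) (ha : -2 < a) (hb : -2 < b)
    (hab : (2 + b) / q = 1 + a) (ha1 : 1 ≤ a) (ha2 : a < 2) :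
    ∃ C : ℝ, 0 < C ∧ ∀ u : KornHardy.Plane → KornHardy.Plane,
      ContDiff ℝ ∞ u → HasCompactSupport u →
        (∫ x : KornHardy.Plane, ‖x‖ ^ b * ‖u x‖ ^ q) ^ (1 / q) ≤
          C * ∫ x : KornHardy.Plane, ‖x‖ ^ a * ‖KornHardy.Dsym u x‖ := by
  obtain ⟨C, hC, hle⟩ := theorem1_general (volume : Measure KornHardy.Plane) hq1 (a := a) (b := b)
    (by norm_num; linarith) (by norm_num; linarith) (by norm_num; linarith)
  refine ⟨C, hC, fun u hu hs => ?_⟩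
  have hu1 : ContDiff ℝ 1 u := hu.of_le (mod_cast le_top)
  grw [hle u hu1 hs, KornHardy.integral_norm_rpow_mul_norm_symmGrad_le hu1 hs ha]
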